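/- For integers $n,d\ge 1$ let $P_{n,d}$ be the graph with vertex set $\{0,1,\dots,n\}$ in which $i$ and $j$ are adjacent if and only if $|i-j|\in\{1,3,\dots,2d+1\}$. Let $\mathrm{Hom}(P_{n,d},0)$ be the (finite, non-empty) set of functions $f\colon\{0,1,\dots,n\}\to\mathbb{Z}$ such that $f(0)=0$ and $|f(i)-f(j)|=1$ whenever $i$ and $j$ are adjacent in $P_{n,d}$, and let $f_{n,d}$ be a uniformly chosen element of $\mathrm{Hom}(P_{n,d},0)$. There exist absolute constants $C,c>0$ such that for any positive integers $n$ and $d$, $$\max\{c\,k\,2^{-d},\,1\}\;\le\;\operatorname{Var}\big(f_{n,d}(k)\big)\;\le\;C\,k\,2^{-d}+4,\qquad 1\le k\le n.$$ -/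

import Mathlib

/-- The homomorphisms from a graph `G` to `ℤ` that vanish at `v₀`: the integer-valued functions
with value `0` at `v₀` which change by exactly one along every edge of `G`. -/
def homZ {V : Type*} (G : SimpleGraph V) (v₀ : V) : Set (V → ℤ) :=
  {f | f v₀ = 0 ∧ ∀ u v : V, G.Adj u v → |f u - f v| = 1}

/-- The graph on the segment `{0, 1, …, n}` in which `i` and `j` are adjacent exactly when
`|i - j| ∈ {1, 3, …, 2 d + 1}`. -/
def lineGraph (n d : ℕ) : SimpleGraph (Fin (n + 1)) where
  Adj i j := ∃ m : ℕ, m ≤ d ∧ |(i : ℤ) - (j : ℤ)| = 2 * (m : ℤ) + 1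
  symm := ⟨by
    rintro i j ⟨m, hm, h⟩
    exact ⟨m, hm, by rw [abs_sub_comm]; exact h⟩⟩
  loopless := ⟨by
    rintro i ⟨m, _, h⟩
    simp only [sub_self, abs_zero] at h
    omega⟩

/-- The law of a uniformly chosen homomorphism from the segment graph to `ℤ` vanishing at `0`:
the uniform probability measure on the (finite, nonempty) set of these homomorphisms. -/
noncomputable def lineHomLaw (n d : ℕ) : MeasureTheory.Measure (Fin (n + 1) → ℤ) :=
  ProbabilityTheory.uniformOn (homZ (lineGraph n d) 0)

/-!
The steps of a homomorphism `f` form runs, on which `f` alternates between two values; a new run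
begins where a step is repeated. Because windows of `2 d + 2` consecutive points span complete
bipartite graphs, a walk with steps `±1` is a homomorphism exactly when every run other than the
first and the last has even length or length at least `2 d + 1`. An even run returns to its
starting value, its centre, and the next run goes in the opposite direction; an odd run moves the
centre by one, and the next run keeps the direction. With `RunState` recording the current run,
the counts and the first and second moments of the displacement obey recursions in the number of
steps and the length of that run (`RunState.card_extending`, `RunState.sum_displacement`,
`RunState.sum_displacement_sq`).

For a run that has just begun, comparing the recursion after two steps (`run_recursion_add_two`)
makes almost everything cancel. With `a`, `e`, `v` the count, first and second moment and `r`
steps to follow, one finds for times beyond `2 d + 1`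

* `a (m + 2 d + 1) = 2 a (m + 2 d - 1) + a m`,
* `e (m + 2 d + 1) = a (m + r) + e m`,
* `v (m + 2 d + 1) = 2 v (m + 2 d - 1) + v m + (a (m + r) + 2 e m)`.

So `a` doubles in every two steps up to a factor `1 + O(2⁻ᵈ)`, and `0 ≤ e m ≤ a (m + r)`. The
recursion for `v` is that for `a` with a source that is of order `2⁻ᵈ` relative to `a`, so that `v
/ a` grows linearly at a rate of order `2⁻ᵈ` (`secondMoment_one_le`, `le_secondMoment_one`). The
first run may have any length, which is the same as starting in a run of length `2 d + 1`; it
accounts for the constant `4` in the upper bound. The lower bound `1` is immediate for odd times,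
and for even times it follows from a two-step induction (`numCont_le_secondMoment_of_even`),
started by the comparison `numCont_long_succ_le`. The mean vanishes by reflection, so the variance
is a ratio of a second moment and a count.
-/

/-! ### The moment recursions -/

/-- The number of ways to continue a homomorphism by `m` further steps when the current run has
length `ℓ`: a run may always be prolonged, and it may end when its length is even or exceeds
`2 d`. -/
def numCont (d : ℕ) : ℕ → ℕ → ℝ
  | 0, _ => 1
  | m + 1, ℓ => numCont d m (ℓ + 1) + if Even ℓ ∨ 2 * d < ℓ then numCont d m 1 else 0

/-- The sum of the displacements after `m` steps over all continuations by `m + r` steps of a run of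
length `ℓ`. Displacements are measured from the centre of the current run, in the direction of the
run. -/
def firstMoment (d r : ℕ) : ℕ → ℕ → ℝ
  | 0, ℓ => if Even ℓ then 0 else numCont d r ℓ
  | m + 1, ℓ => firstMoment d r m (ℓ + 1) +
      if Even ℓ then -firstMoment d r m 1
      else if 2 * d < ℓ then numCont d (m + r) 1 + firstMoment d r m 1 else 0

/-- The sum of the squared displacements after `m` steps over all continuations by `m + r` steps of
a run of length `ℓ`, with displacements measured from the centre of the current run. -/
def secondMoment (d r : ℕ) : ℕ → ℕ → ℝ
  | 0, ℓ => if Even ℓ then 0 else numCont d r ℓ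
  | m + 1, ℓ => secondMoment d r m (ℓ + 1) +
      if Even ℓ then secondMoment d r m 1
      else if 2 * d < ℓ then
        numCont d (m + r) 1 + 2 * firstMoment d r m 1 + secondMoment d r m 1 else 0

/-! ### The run structure of homomorphisms -/

theorem mem_homZ_lineGraph_iff {n d : ℕ} {g : Fin (n + 1) → ℤ} :
    g ∈ homZ (lineGraph n d) 0 ↔ g 0 = 0 ∧ ∀ i j : Fin (n + 1), (i : ℕ) < j →
      (j : ℕ) ≤ i + 2 * d + 1 → Odd ((i : ℕ) + j) → |g j - g i| = 1 := by
  constructor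
  · rintro ⟨h0, h⟩
    refine ⟨h0, fun i j hij hd ho => h j i ?_⟩
    obtain ⟨t, ht⟩ := ho
    refine ⟨t - i, by omega, ?_⟩
    rw [abs_of_pos (by omega)]
    omega
  · rintro ⟨h0, h⟩
    refine ⟨h0, fun u v => ?_⟩
    rintro ⟨m, hm, huv⟩
    rcases abs_eq (by positivity) |>.1 huv with huv | huv
    · exact h v u (by omega) (by omega) ⟨v + m, by omega⟩
    · rw [abs_sub_comm]
      exact h u v (by omega) (by omega) ⟨u + m, by omega⟩

theorem homZ_lineGraph_finite (n d : ℕ) : (homZ (lineGraph n d) 0).Finite := by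
  refine (Set.finite_Icc (fun i : Fin (n + 1) => -((i : ℕ) : ℤ)) (fun i => ((i : ℕ) : ℤ))).subset ?_
  intro g hg
  obtain ⟨h0, h⟩ := mem_homZ_lineGraph_iff.1 hg
  have key : ∀ i : ℕ, ∀ hi : i < n + 1, |g ⟨i, hi⟩| ≤ i := by
    intro i
    induction i with
    | zero => intro hi; simpa using h0
    | succ i ih =>
      intro hi
      have h1 := ih (by omega)
      have h2 := h ⟨i, by omega⟩ ⟨i + 1, hi⟩ (by simp) (by simp only; omega)
        ⟨i, by simp only; omega⟩
      have h3 := abs_sub_abs_le_abs_sub (g ⟨i + 1, hi⟩) (g ⟨i, by omega⟩)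
      push_cast
      linarith
  exact ⟨fun i => (abs_le.1 (key i i.2)).1, fun i => (abs_le.1 (key i i.2)).2⟩

/-- The homomorphisms from the segment graph to `ℤ` vanishing at `0`, as a finite set. -/
noncomputable def homFinset (n d : ℕ) : Finset (Fin (n + 1) → ℤ) :=
  (homZ_lineGraph_finite n d).toFinset

/-- The homomorphisms on `{0, …, N}` that agree with `f` on `{0, …, n}`. -/
noncomputable def extending (N d n : ℕ) (f : ℕ → ℤ) : Finset (Fin (N + 1) → ℤ) :=
  (homFinset N d).filter fun g => ∀ i : Fin (N + 1), (i : ℕ) ≤ n → g i = f i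

theorem mem_extending {N d n : ℕ} {f : ℕ → ℤ} {g : Fin (N + 1) → ℤ} :
    g ∈ extending N d n f ↔
      g ∈ homFinset N d ∧ ∀ i : Fin (N + 1), (i : ℕ) ≤ n → g i = f i := by
  simp [extending]

theorem mem_homFinset {n d : ℕ} {g : Fin (n + 1) → ℤ} :
    g ∈ homFinset n d ↔ g 0 = 0 ∧ ∀ i j : Fin (n + 1), (i : ℕ) < j →
      (j : ℕ) ≤ i + 2 * d + 1 → Odd ((i : ℕ) + j) → |g j - g i| = 1 := by
  simp [homFinset, mem_homZ_lineGraph_iff]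

/-- The restriction of `f` to `{0, …, n}` is a homomorphism whose current run, a maximal final
stretch on which `f` alternates between two values, has length `ℓ`, centre `c` and direction `σ`.
The centre is the value at the point `n - ℓ` where the run started, and `c + σ` is the other value
of the run. In the window of the last `2 d + 1` points, which is all that constrains the next value,
every point of the parity of `n - ℓ` has value `c`. The initial run is given the length `2 d + n`,
so that it may end at any time; a run of length at most `2 d` has really been started by a repeated
step, so that the value before its starting point is `c - σ`. -/
structure RunState (d n : ℕ) (f : ℕ → ℤ) (ℓ : ℕ) (c σ : ℤ) : Prop where
  zero : f 0 = 0
  hom : ∀ i j, i < j → j ≤ n → j ≤ i + 2 * d + 1 → Odd (i + j) → |f j - f i| = 1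
  sign : σ = 1 ∨ σ = -1
  length_pos : 1 ≤ ℓ
  one_le : 1 ≤ n
  center : ∀ j, j ≤ n → n ≤ j + 2 * d → Even (n + ℓ + j) → f j = c
  run : ∀ j, j ≤ n → n ≤ j + 2 * d → Odd (n + ℓ + j) → n < j + ℓ → f j = c + σ
  side : ∀ j, j ≤ n → n ≤ j + 2 * d → Odd (n + ℓ + j) → f j = c + 1 ∨ f j = c - 1
  start : ℓ ≤ 2 * d → ∃ j, j + ℓ + 1 = n ∧ f j = c - σ

namespace RunState

variable {d n ℓ : ℕ} {f : ℕ → ℤ} {c σ : ℤ}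

theorem last_even (h : RunState d n f ℓ c σ) (hℓ : Even ℓ) : f n = c :=
  h.center n le_rfl (by omega) (by grind)

theorem last_odd (h : RunState d n f ℓ c σ) (hℓ : ¬ Even ℓ) : f n = c + σ :=
  h.run n le_rfl (by omega) (by grind) (by have := h.length_pos; omega)

/-- The new value only has to be compared with the values at the points of the parity of `n` in the
window. -/
theorem hom_update (h : RunState d n f ℓ c σ) {x : ℤ}
    (hx : ∀ j, j ≤ n → n ≤ j + 2 * d → Even (n + j) → |x - f j| = 1) :
    ∀ i j, i < j → j ≤ n + 1 → j ≤ i + 2 * d + 1 → Odd (i + j) →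
      |Function.update f (n + 1) x j - Function.update f (n + 1) x i| = 1 := by
  intro i j hij hj hd ho
  rw [Function.update_of_ne (by omega : i ≠ n + 1)]
  rcases Nat.lt_or_ge n j with hnj | hnj
  · obtain rfl : j = n + 1 := by omega
    rw [Function.update_self]
    exact hx i (by omega) (by omega) (by grind)
  · rw [Function.update_of_ne (by omega : j ≠ n + 1)]
    exact h.hom i j hij hnj hd ho

/-- Prolonging the current run. -/
theorem prolong (h : RunState d n f ℓ c σ) :
    RunState d (n + 1) (Function.update f (n + 1) (if Even ℓ then c + σ else c)) (ℓ + 1) c σ := by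
  have hs := h.sign
  have upd : ∀ x j, j ≤ n → Function.update f (n + 1) x j = f j := fun x j hj =>
    Function.update_of_ne (by omega) _ _
  refine ⟨by rw [upd _ _ (by omega), h.zero], ?_, hs, by omega, by omega, ?_, ?_, ?_, ?_⟩
  · refine h.hom_update fun j hj hjd he => ?_
    split_ifs with hℓ
    · rw [h.center j hj hjd (by grind)]
      rcases hs with rfl | rfl <;> simp
    · rcases h.side j hj hjd (by grind) with h1 | h1 <;> rw [h1] <;> simp
  · intro j hj hjd he
    rcases Nat.lt_or_ge n j with hnj | hnj
    · obtain rfl : j = n + 1 := by omega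
      rw [Function.update_self, if_neg (by grind)]
    · rw [upd _ _ hnj]
      exact h.center j hnj (by omega) (by grind)
  · intro j hj hjd he hjl
    rcases Nat.lt_or_ge n j with hnj | hnj
    · obtain rfl : j = n + 1 := by omega
      rw [Function.update_self, if_pos (by grind)]
    · rw [upd _ _ hnj]
      exact h.run j hnj (by omega) (by grind) (by omega)
  · intro j hj hjd he
    rcases Nat.lt_or_ge n j with hnj | hnj
    · obtain rfl : j = n + 1 := by omega
      rw [Function.update_self, if_pos (by grind)]
      rcases hs with rfl | rfl <;> simp [sub_eq_add_neg]
    · rw [upd _ _ hnj]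
      exact h.side j hnj (by omega) (by grind)
  · intro hl
    obtain ⟨j, hj, hfj⟩ := h.start (by omega)
    exact ⟨j, by omega, by rw [upd _ _ (by omega), hfj]⟩

/-- Ending a run of even length reverses the direction and keeps the centre. -/
theorem switch_even (hd : 1 ≤ d) (h : RunState d n f ℓ c σ) (hℓ : Even ℓ) :
    RunState d (n + 1) (Function.update f (n + 1) (c - σ)) 1 c (-σ) := by
  have hs := h.sign
  have hn := h.one_le
  have hp := h.length_pos
  have upd : ∀ x j, j ≤ n → Function.update f (n + 1) x j = f j := fun x j hj =>
    Function.update_of_ne (by omega) _ _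
  have hℓ2 : 2 ≤ ℓ := by grind
  refine ⟨by rw [upd _ _ (by omega), h.zero], ?_, by omega, le_rfl, by omega, ?_, ?_, ?_, ?_⟩
  · refine h.hom_update fun j hj hjd he => ?_
    rw [h.center j hj hjd (by grind)]
    rcases hs with rfl | rfl <;> simp
  · intro j hj hjd he
    have hnj : j ≤ n := by grind
    rw [upd _ _ hnj]
    exact h.center j hnj (by omega) (by grind)
  · intro j hj hjd he hjl
    obtain rfl : j = n + 1 := by omega
    rw [Function.update_self, sub_eq_add_neg]
  · intro j hj hjd he
    rcases Nat.lt_or_ge n j with hnj | hnj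
    · obtain rfl : j = n + 1 := by omega
      rw [Function.update_self]
      rcases hs with rfl | rfl <;> simp
    · rw [upd _ _ hnj]
      exact h.side j hnj (by omega) (by grind)
  · intro _
    refine ⟨n - 1, by omega, ?_⟩
    rw [upd _ _ (by omega), h.run (n - 1) (by omega) (by omega) (by grind) (by omega)]
    ring

/-- Ending a run of odd length keeps the direction and moves the centre by one. -/
theorem switch_odd (hd : 1 ≤ d) (h : RunState d n f ℓ c σ) (hℓ : ¬ Even ℓ) (hℓd : 2 * d < ℓ) :
    RunState d (n + 1) (Function.update f (n + 1) (c + 2 * σ)) 1 (c + σ) σ := by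
  have hs := h.sign
  have hn := h.one_le
  have upd : ∀ x j, j ≤ n → Function.update f (n + 1) x j = f j := fun x j hj =>
    Function.update_of_ne (by omega) _ _
  refine ⟨by rw [upd _ _ (by omega), h.zero], ?_, hs, le_rfl, by omega, ?_, ?_, ?_, ?_⟩
  · refine h.hom_update fun j hj hjd he => ?_
    rw [h.run j hj hjd (by grind) (by omega)]
    rcases hs with rfl | rfl <;> norm_num
  · intro j hj hjd he
    have hnj : j ≤ n := by grind
    rw [upd _ _ hnj]
    exact h.run j hnj (by omega) (by grind) (by omega)
  · intro j hj hjd he hjl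
    obtain rfl : j = n + 1 := by omega
    rw [Function.update_self]
    ring
  · intro j hj hjd he
    rcases Nat.lt_or_ge n j with hnj | hnj
    · obtain rfl : j = n + 1 := by omega
      rw [Function.update_self]
      omega
    · rw [upd _ _ hnj, h.center j hnj (by omega) (by grind)]
      omega
  · intro _
    refine ⟨n - 1, by omega, ?_⟩
    rw [upd _ _ (by omega), h.center (n - 1) (by omega) (by omega) (by grind)]
    ring

/-- A homomorphism on an initial segment is continued by prolonging its run or, when the length of
the run permits, by ending it. -/
theorem sum_extending (h : RunState d n f ℓ c σ) {N : ℕ} (hN : n < N)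
    (φ : (Fin (N + 1) → ℤ) → ℝ) :
    ∑ g ∈ extending N d n f, φ g =
      ∑ g ∈ extending N d (n + 1) (Function.update f (n + 1) (if Even ℓ then c + σ else c)), φ g +
      if Even ℓ ∨ 2 * d < ℓ then
        ∑ g ∈ extending N d (n + 1)
          (Function.update f (n + 1) (if Even ℓ then c - σ else c + 2 * σ)), φ g
      else 0 := by
  classical
  have hs := h.sign
  have mem : ∀ x g, g ∈ extending N d (n + 1) (Function.update f (n + 1) x) ↔
      g ∈ extending N d n f ∧ g ⟨n + 1, by omega⟩ = x := by
    intro x g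
    rw [mem_extending, mem_extending, and_assoc]
    refine and_congr_right fun _ => ⟨fun hg => ⟨fun i hi => ?_, ?_⟩, fun hg i hi => ?_⟩
    · rw [hg i (by omega), Function.update_of_ne (by omega)]
    · rw [hg _ le_rfl, Function.update_self]
    · rcases Nat.lt_or_ge n i with hni | hni
      · have hi' : i = ⟨n + 1, by omega⟩ := Fin.ext (by simp; omega)
        rw [hi', hg.2, Function.update_self]
      · rw [hg.1 i hni, Function.update_of_ne (by omega)]
  have hstep : ∀ g ∈ extending N d n f, g ⟨n + 1, by omega⟩ = (if Even ℓ then c + σ else c) ∨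
      g ⟨n + 1, by omega⟩ = (if Even ℓ then c - σ else c + 2 * σ) := by
    intro g hg
    rw [mem_extending, mem_homFinset] at hg
    have h1 := hg.1.2 ⟨n, by omega⟩ ⟨n + 1, by omega⟩ (by simp) (by simp only; omega)
      ⟨n, by simp only; omega⟩
    rw [hg.2 ⟨n, by omega⟩ le_rfl] at h1
    by_cases hℓ : Even ℓ
    · have h2 : f (⟨n, by omega⟩ : Fin (N + 1)) = c := h.last_even hℓ
      rw [h2] at h1
      simp only [hℓ, if_true]
      rcases (abs_eq zero_le_one).1 h1 with h1 | h1 <;> omega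
    · have h2 : f (⟨n, by omega⟩ : Fin (N + 1)) = c + σ := h.last_odd hℓ
      rw [h2] at h1
      simp only [hℓ, if_false]
      rcases (abs_eq zero_le_one).1 h1 with h1 | h1 <;> omega
  have hsplit : extending N d n f =
      extending N d (n + 1) (Function.update f (n + 1) (if Even ℓ then c + σ else c)) ∪
      extending N d (n + 1) (Function.update f (n + 1) (if Even ℓ then c - σ else c + 2 * σ)) := by
    ext g
    rw [Finset.mem_union, mem, mem]
    constructor
    · intro hg
      rcases hstep g hg with h1 | h1
      · exact Or.inl ⟨hg, h1⟩
      · exact Or.inr ⟨hg, h1⟩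
    · rintro (hg | hg) <;> exact hg.1
  have hdisj : Disjoint
      (extending N d (n + 1) (Function.update f (n + 1) (if Even ℓ then c + σ else c)))
      (extending N d (n + 1)
        (Function.update f (n + 1) (if Even ℓ then c - σ else c + 2 * σ))) := by
    rw [Finset.disjoint_left]
    intro g hg hg'
    rw [mem] at hg hg'
    have h1 := hg.2.symm.trans hg'.2
    split_ifs at h1 <;> omega
  rw [hsplit, Finset.sum_union hdisj]
  congr 1
  by_cases hok : Even ℓ ∨ 2 * d < ℓ
  · rw [if_pos hok]
  · rw [if_neg hok, if_neg (by tauto)]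
    -- Ending a short run of odd length would break the edge to the point before the run.
    refine Finset.sum_eq_zero fun g hg => ?_
    exfalso
    have hodd : Odd ℓ := by grind
    have hne : ℓ + 1 ≤ 2 * d := by grind
    rw [mem] at hg
    obtain ⟨j, hj, hfj⟩ := h.start (by omega)
    have h1 := hg.1
    rw [mem_extending, mem_homFinset] at h1
    have h2 := h1.1.2 ⟨j, by omega⟩ ⟨n + 1, by omega⟩ (by simp only; omega) (by simp only; omega)
      (by simp only; grind)
    have h3 : g ⟨j, by omega⟩ = c - σ := by rw [h1.2 ⟨j, by omega⟩ (by simp; omega)]; exact hfj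
    rw [hg.2, h3] at h2
    rcases (abs_eq zero_le_one).1 h2 with h2 | h2 <;> omega

theorem extending_self {N : ℕ} (h : RunState d N f ℓ c σ) :
    extending N d N f = {fun i : Fin (N + 1) => f i} := by
  ext g
  rw [mem_extending, Finset.mem_singleton]
  constructor
  · rintro ⟨_, hg⟩
    funext i
    exact hg i (by omega)
  · rintro rfl
    refine ⟨mem_homFinset.2 ⟨h.zero, fun i j hij hd ho => ?_⟩, fun _ _ => rfl⟩
    exact h.hom i j hij (by omega) hd ho

theorem card_extending (hd : 1 ≤ d) {N m : ℕ} (h : RunState d n f ℓ c σ) (hN : n + m = N) :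
    ∑ _g ∈ extending N d n f, (1 : ℝ) = numCont d m ℓ := by
  induction m generalizing n f ℓ c σ with
  | zero =>
    obtain rfl : n = N := by omega
    rw [h.extending_self, Finset.sum_singleton, numCont]
  | succ m ih =>
    rw [h.sum_extending (by omega), ih (h.prolong) (by omega), numCont]
    congr 1
    by_cases hℓ : Even ℓ
    · rw [if_pos (Or.inl hℓ), if_pos hℓ, if_pos (Or.inl hℓ),
        ih (h.switch_even hd hℓ) (by omega)]
    · by_cases hℓd : 2 * d < ℓ
      · rw [if_pos (Or.inr hℓd), if_neg hℓ, if_pos (Or.inr hℓd),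
          ih (h.switch_odd hd hℓ hℓd) (by omega)]
      · rw [if_neg (by tauto), if_neg (by tauto)]

/-- The value at the current end of the domain, measured from the centre, is `0` or `σ` according to
the parity of the run. -/
theorem extending_apply {N : ℕ} (h : RunState d n f ℓ c σ) (hN : n < N + 1)
    {g : Fin (N + 1) → ℤ} (hg : g ∈ extending N d n f) :
    g ⟨n, hN⟩ = if Even ℓ then c else c + σ := by
  rw [mem_extending] at hg
  rw [hg.2 ⟨n, hN⟩ le_rfl]
  split_ifs with hℓ
  · exact h.last_even hℓ
  · exact h.last_odd hℓ

theorem sum_displacement (hd : 1 ≤ d) {N r k m : ℕ} (h : RunState d n f ℓ c σ)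
    (hk : n + m = k) (hN : k + r = N) :
    ∑ g ∈ extending N d n f, (σ : ℝ) * ((g ⟨k, by omega⟩ : ℝ) - c) = firstMoment d r m ℓ := by
  induction m generalizing n f ℓ c σ with
  | zero =>
    obtain rfl : n = k := by omega
    have hs : (σ : ℝ) * σ = 1 := by rcases h.sign with hs | hs <;> rw [hs] <;> norm_num
    rw [firstMoment, ← h.card_extending hd hN]
    split_ifs with hℓ
    · refine Finset.sum_eq_zero fun g hg => ?_
      rw [h.extending_apply (by omega) hg, if_pos hℓ]
      ring
    · refine Finset.sum_congr rfl fun g hg => ?_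
      rw [h.extending_apply (by omega) hg, if_neg hℓ]
      push_cast
      linear_combination hs
  | succ m ih =>
    have hs : (σ : ℝ) * σ = 1 := by rcases h.sign with hs | hs <;> rw [hs] <;> norm_num
    rw [h.sum_extending (by omega), ih (h.prolong) (by omega), firstMoment]
    congr 1
    by_cases hℓ : Even ℓ
    · rw [if_pos (Or.inl hℓ), if_pos hℓ, if_pos hℓ, ← ih (h.switch_even hd hℓ) (by omega),
        ← Finset.sum_neg_distrib]
      refine Finset.sum_congr rfl fun g _ => ?_
      push_cast
      ring
    · by_cases hℓd : 2 * d < ℓ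
      · have h' := h.switch_odd hd hℓ hℓd
        rw [if_pos (Or.inr hℓd), if_neg hℓ, if_neg hℓ, if_pos hℓd, ← ih h' (by omega),
          ← h'.card_extending hd (by omega : n + 1 + (m + r) = N), ← Finset.sum_add_distrib]
        refine Finset.sum_congr rfl fun g _ => ?_
        push_cast
        linear_combination hs
      · rw [if_neg (by tauto), if_neg hℓ, if_neg hℓd]

theorem sum_displacement_sq (hd : 1 ≤ d) {N r k m : ℕ} (h : RunState d n f ℓ c σ)
    (hk : n + m = k) (hN : k + r = N) :
    ∑ g ∈ extending N d n f, ((g ⟨k, by omega⟩ : ℝ) - c) ^ 2 = secondMoment d r m ℓ := by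
  induction m generalizing n f ℓ c σ with
  | zero =>
    obtain rfl : n = k := by omega
    have hs : (σ : ℝ) * σ = 1 := by rcases h.sign with hs | hs <;> rw [hs] <;> norm_num
    rw [secondMoment, ← h.card_extending hd hN]
    split_ifs with hℓ
    · refine Finset.sum_eq_zero fun g hg => ?_
      rw [h.extending_apply (by omega) hg, if_pos hℓ]
      ring
    · refine Finset.sum_congr rfl fun g hg => ?_
      rw [h.extending_apply (by omega) hg, if_neg hℓ]
      push_cast
      linear_combination hs
  | succ m ih =>
    have hs : (σ : ℝ) * σ = 1 := by rcases h.sign with hs | hs <;> rw [hs] <;> norm_num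
    rw [h.sum_extending (by omega), ih (h.prolong) (by omega), secondMoment]
    congr 1
    by_cases hℓ : Even ℓ
    · rw [if_pos (Or.inl hℓ), if_pos hℓ, if_pos hℓ, ← ih (h.switch_even hd hℓ) (by omega)]
    · by_cases hℓd : 2 * d < ℓ
      · have h' := h.switch_odd hd hℓ hℓd
        rw [if_pos (Or.inr hℓd), if_neg hℓ, if_neg hℓ, if_pos hℓd, ← ih h' (by omega),
          ← h'.card_extending hd (by omega : n + 1 + (m + r) = N),
          ← h'.sum_displacement hd (by omega) hN,
          Finset.mul_sum, ← Finset.sum_add_distrib, ← Finset.sum_add_distrib]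
        refine Finset.sum_congr rfl fun g _ => ?_
        push_cast
        linear_combination hs
      · rw [if_neg (by tauto), if_neg hℓ, if_neg hℓd]

end RunState

/-- After the first step the run is declared to be long, since it may end at any time. -/
theorem runState_one {d : ℕ} {σ : ℤ} (hσ : σ = 1 ∨ σ = -1) :
    RunState d 1 (fun i => if i = 1 then σ else 0) (2 * d + 1) 0 σ := by
  refine ⟨by simp, ?_, hσ, by omega, le_rfl, ?_, ?_, ?_, by omega⟩
  · intro i j hij hj _ _
    obtain rfl : j = 1 := by omega
    obtain rfl : i = 0 := by omega
    rcases hσ with rfl | rfl <;> simp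
  · intro j _ _ hj
    rw [if_neg (by grind)]
  · intro j _ _ hj _
    rw [if_pos (by grind), zero_add]
  · intro j _ _ hj
    rw [if_pos (by grind)]
    simpa using hσ

/-- Every homomorphism starts with a step up or a step down. -/
theorem sum_homFinset {n d : ℕ} (hn : 1 ≤ n) (φ : (Fin (n + 1) → ℤ) → ℝ) :
    ∑ g ∈ homFinset n d, φ g =
      ∑ g ∈ extending n d 1 (fun i => if i = 1 then 1 else 0), φ g +
      ∑ g ∈ extending n d 1 (fun i => if i = 1 then -1 else 0), φ g := by
  classical
  have mem : ∀ (x : ℤ) g, g ∈ extending n d 1 (fun i => if i = 1 then x else 0) ↔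
      g ∈ homFinset n d ∧ g ⟨1, by omega⟩ = x := by
    intro x g
    rw [mem_extending]
    refine and_congr_right fun hg => ⟨fun h => by simpa using h ⟨1, by omega⟩ le_rfl,
      fun h i hi => ?_⟩
    rcases Nat.le_one_iff_eq_zero_or_eq_one.1 hi with hi | hi
    · obtain rfl : i = 0 := Fin.ext hi
      simpa using (mem_homFinset.1 hg).1
    · have hi' : i = ⟨1, by omega⟩ := Fin.ext hi
      simpa [hi'] using h
  rw [← Finset.sum_union]
  · congr 1
    ext g
    rw [Finset.mem_union, mem, mem, ← and_or_left, iff_self_and]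
    intro hg
    obtain ⟨h0, h1⟩ := mem_homFinset.1 hg
    have h2 := h1 0 ⟨1, by omega⟩ (by simp) (by simp) (by simp)
    rw [h0, sub_zero] at h2
    exact (abs_eq zero_le_one).1 h2
  · rw [Finset.disjoint_left]
    intro g hg hg'
    rw [mem] at hg hg'
    have := hg.2.symm.trans hg'.2
    omega

theorem card_homFinset {n d : ℕ} (hd : 1 ≤ d) {m : ℕ} (hn : m + 1 = n) :
    ((homFinset n d).card : ℝ) = 2 * numCont d m (2 * d + 1) := by
  have h := sum_homFinset (d := d) (by omega : 1 ≤ n) fun _ => 1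
  rw [(runState_one (Or.inl rfl)).card_extending hd (by omega : 1 + m = n),
    (runState_one (Or.inr rfl)).card_extending hd (by omega : 1 + m = n), Finset.sum_const,
    nsmul_eq_mul, mul_one] at h
  rw [h]
  ring

theorem sum_sq_homFinset {n d : ℕ} (hd : 1 ≤ d) (k : Fin (n + 1)) {m r : ℕ} (hk : m + 1 = k)
    (hn : k + r = n) :
    ∑ g ∈ homFinset n d, (g k : ℝ) ^ 2 = 2 * secondMoment d r m (2 * d + 1) := by
  have key : ∀ σ : ℤ, σ = 1 ∨ σ = -1 →
      ∑ g ∈ extending n d 1 (fun i => if i = 1 then σ else 0), (g k : ℝ) ^ 2 =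
        secondMoment d r m (2 * d + 1) := by
    intro σ hσ
    rw [← (runState_one hσ).sum_displacement_sq hd (by omega : 1 + m = k) hn]
    simp
  rw [sum_homFinset (by omega), key 1 (Or.inl rfl), key (-1) (Or.inr rfl)]
  ring

/-! ### Growth of the number of continuations -/

section Analysis

variable {d : ℕ}

theorem numCont_pos (m ℓ : ℕ) : 0 < numCont d m ℓ := by
  induction m generalizing ℓ with
  | zero => simp [numCont]
  | succ m ih =>
    rw [numCont]
    have h1 := ih (ℓ + 1)
    have h2 := ih 1
    split_ifs <;> linarith

theorem one_le_numCont (m ℓ : ℕ) : 1 ≤ numCont d m ℓ := by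
  induction m generalizing ℓ with
  | zero => simp [numCont]
  | succ m ih =>
    rw [numCont]
    have h1 := ih (ℓ + 1)
    have h2 := ih 1
    split_ifs <;> linarith

theorem numCont_le_succ (m ℓ : ℕ) : numCont d m ℓ ≤ numCont d (m + 1) ℓ := by
  induction m generalizing ℓ with
  | zero => exact one_le_numCont _ _
  | succ m ih =>
    rw [numCont, numCont]
    have h1 := ih (ℓ + 1)
    have h2 := ih 1
    split_ifs <;> linarith

theorem numCont_mono (ℓ : ℕ) : Monotone fun m => numCont d m ℓ :=
  monotone_nat_of_le_succ fun m => numCont_le_succ m ℓ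

/-- A quantity that obeys a recursion over the steps of a run is insensitive to increasing the
length of a long run by two, if its initial values are. -/
theorem eq_of_run_recursion {X : ℕ → ℕ → ℝ} {P Q : ℕ → ℝ}
    (hX : ∀ m ℓ, X (m + 1) ℓ =
      X m (ℓ + 1) + if Even ℓ then P m else if 2 * d < ℓ then Q m else 0)
    (h0 : ∀ ℓ, 2 * d ≤ ℓ → X 0 (ℓ + 2) = X 0 ℓ) (m ℓ : ℕ) (hℓ : 2 * d ≤ ℓ) :
    X m (ℓ + 2) = X m ℓ := by
  induction m generalizing ℓ with
  | zero => exact h0 ℓ hℓ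
  | succ m ih =>
    rw [hX, hX m ℓ, show ℓ + 2 + 1 = ℓ + 1 + 2 by ring, ih (ℓ + 1) (by omega)]
    by_cases h1 : Even ℓ
    · rw [if_pos h1, if_pos (by grind)]
    · rw [if_neg h1, if_neg (by grind), if_pos (by grind), if_pos (by grind)]

/-- Increasing the length of a short run by two makes a difference only if the run goes on up to the
point where the longer run, having reached length `2 d + 1`, may end while the shorter one
may not. -/
theorem run_recursion_add_two {X : ℕ → ℕ → ℝ} {P Q : ℕ → ℝ}
    (hX : ∀ m ℓ, X (m + 1) ℓ =
      X m (ℓ + 1) + if Even ℓ then P m else if 2 * d < ℓ then Q m else 0)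
    (h0 : ∀ ℓ, 2 * d ≤ ℓ → X 0 (ℓ + 2) = X 0 ℓ) (m i ℓ : ℕ) (hℓ : ℓ + i + 1 = 2 * d) :
    X (m + i + 1) (ℓ + 2) = X (m + i + 1) ℓ + Q m := by
  induction i generalizing ℓ with
  | zero =>
    have hne : ¬ Even ℓ := by grind
    rw [add_zero, hX, hX m ℓ, show ℓ + 2 + 1 = ℓ + 1 + 2 by ring,
      eq_of_run_recursion hX h0 m (ℓ + 1) (by omega), if_neg hne, if_neg (by grind),
      if_pos (by omega), if_neg (by omega)]
    ring
  | succ i ih =>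
    rw [show m + (i + 1) + 1 = m + i + 1 + 1 by ring, hX, hX _ ℓ,
      show ℓ + 2 + 1 = ℓ + 1 + 2 by ring, ih (ℓ + 1) (by omega)]
    by_cases h1 : Even ℓ
    · rw [if_pos h1, if_pos (by grind)]
      ring
    · rw [if_neg h1, if_neg (by grind), if_neg (by omega), if_neg (by grind)]
      ring

/-- If neither run gets as far as length `2 d + 1`, the difference is that of the initial values. -/
theorem run_recursion_add_two_of_lt {X : ℕ → ℕ → ℝ} {P Q : ℕ → ℝ}
    (hX : ∀ m ℓ, X (m + 1) ℓ =
      X m (ℓ + 1) + if Even ℓ then P m else if 2 * d < ℓ then Q m else 0)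
    (m ℓ : ℕ) (hℓ : ℓ + m + 1 ≤ 2 * d) :
    X m (ℓ + 2) - X m ℓ = X 0 (ℓ + m + 2) - X 0 (ℓ + m) := by
  induction m generalizing ℓ with
  | zero => rfl
  | succ m ih =>
    rw [hX, hX _ ℓ, show ℓ + (m + 1) = ℓ + 1 + m by ring, ← ih (ℓ + 1) (by omega),
      show ℓ + 2 + 1 = ℓ + 1 + 2 by ring]
    by_cases h1 : Even ℓ
    · rw [if_pos h1, if_pos (by grind)]
      ring
    · rw [if_neg h1, if_neg (by grind), if_neg (by omega), if_neg]
      · ring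
      · grind

theorem numCont_recursion (m ℓ : ℕ) : numCont d (m + 1) ℓ = numCont d m (ℓ + 1) +
    if Even ℓ then numCont d m 1 else if 2 * d < ℓ then numCont d m 1 else 0 := by
  rw [numCont]
  by_cases h1 : Even ℓ <;> by_cases h2 : 2 * d < ℓ <;> simp [h1, h2]

theorem numCont_add_two_of_long (m ℓ : ℕ) (hℓ : 2 * d ≤ ℓ) :
    numCont d m (ℓ + 2) = numCont d m ℓ :=
  eq_of_run_recursion numCont_recursion (fun _ _ => rfl) m ℓ hℓ

theorem numCont_succ_of_long (m ℓ : ℕ) (hℓ : 2 * d < ℓ) :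
    numCont d (m + 1) ℓ = numCont d m ℓ + numCont d m 1 := by
  induction m generalizing ℓ with
  | zero => simp [numCont, hℓ]
  | succ m ih =>
    have h1 : numCont d (m + 1) ℓ = numCont d m (ℓ + 1) + numCont d m 1 := by
      rw [numCont, if_pos (Or.inr hℓ)]
    rw [h1, ← ih (ℓ + 1) (by omega)]
    conv_lhs => rw [numCont, if_pos (Or.inr hℓ)]

theorem numCont_eq_of_long (m ℓ ℓ' : ℕ) (hℓ : 2 * d < ℓ) (hℓ' : 2 * d < ℓ') :
    numCont d m ℓ = numCont d m ℓ' := by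
  induction m with
  | zero => rfl
  | succ m ih => rw [numCont_succ_of_long m ℓ hℓ, numCont_succ_of_long m ℓ' hℓ', ih]

theorem numCont_one_add_two_eq (hd : 1 ≤ d) (m : ℕ) :
    numCont d (m + 2) 1 = numCont d m 3 + numCont d m 1 := by
  have h1 : ¬ (Even 1 ∨ 2 * d < 1) := by
    rintro (h | h)
    · exact absurd h (by decide)
    · omega
  rw [numCont, numCont, if_neg h1, if_pos (Or.inl (by decide)), add_zero]

/-- The growth recursion, where `2 d + 1` is the least odd length of a complete run. -/
theorem numCont_one_add (hd : 1 ≤ d) (j : ℕ) :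
    numCont d (j + 2 * d + 1) 1 = 2 * numCont d (j + 2 * d - 1) 1 + numCont d j 1 := by
  have h := run_recursion_add_two (d := d) numCont_recursion (fun _ _ => rfl) j (2 * d - 2) 1
    (by omega)
  rw [show j + (2 * d - 2) + 1 = j + 2 * d - 1 by omega] at h
  rw [show j + 2 * d + 1 = j + 2 * d - 1 + 2 by omega, numCont_one_add_two_eq hd, h]
  ring

theorem numCont_one_add_two_of_lt (hd : 1 ≤ d) (m : ℕ) (hm : m + 2 ≤ 2 * d) :
    numCont d (m + 2) 1 = 2 * numCont d m 1 := by
  have h := run_recursion_add_two_of_lt (d := d) numCont_recursion m 1 (by omega)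
  simp only [numCont, Nat.reduceAdd] at h
  rw [numCont_one_add_two_eq hd]
  linarith

theorem two_mul_numCont_le (hd : 1 ≤ d) (m : ℕ) :
    2 * numCont d m 1 ≤ numCont d (m + 2) 1 := by
  rcases Nat.lt_or_ge (2 * d) (m + 2) with h | h
  · obtain ⟨j, rfl⟩ : ∃ j, m = j + 2 * d - 1 := ⟨m + 1 - 2 * d, by omega⟩
    rw [show j + 2 * d - 1 + 2 = j + 2 * d + 1 by omega, numCont_one_add hd]
    linarith [numCont_pos (d := d) j 1]
  · exact (numCont_one_add_two_of_lt hd m h).ge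

theorem two_pow_mul_numCont_le (hd : 1 ≤ d) (m i : ℕ) :
    2 ^ i * numCont d m 1 ≤ numCont d (m + 2 * i) 1 := by
  induction i with
  | zero => simp
  | succ i ih =>
    have := two_mul_numCont_le hd (m + 2 * i)
    rw [show m + 2 * (i + 1) = m + 2 * i + 2 by ring, pow_succ]
    linarith

/-- In two steps the number of continuations grows by a factor of at most `2 (1 + 2⁻ᵈ)`. -/
theorem numCont_add_two_le (hd : 1 ≤ d) (m : ℕ) :
    numCont d (m + 2) 1 ≤ 2 * (1 + (2 ^ d)⁻¹) * numCont d m 1 := by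
  have hp : (0 : ℝ) < 2 ^ d := by positivity
  rcases Nat.lt_or_ge (2 * d) (m + 2) with h | h
  · obtain ⟨j, rfl⟩ : ∃ j, m = j + 2 * d - 1 := ⟨m + 1 - 2 * d, by omega⟩
    rw [show j + 2 * d - 1 + 2 = j + 2 * d + 1 by omega, numCont_one_add hd]
    have h1 := two_pow_mul_numCont_le hd j (d - 1)
    have h2 : numCont d (j + 2 * (d - 1)) 1 ≤ numCont d (j + 2 * d - 1) 1 :=
      numCont_mono 1 (by omega)
    have h3 : (2 : ℝ) ^ d = 2 * 2 ^ (d - 1) := by rw [← pow_succ']; congr 1; omega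
    have h4 : numCont d j 1 ≤ 2 * (2 ^ d)⁻¹ * numCont d (j + 2 * d - 1) 1 := by
      rw [mul_assoc, mul_left_comm, le_inv_mul_iff₀ hp, h3]
      linarith
    linarith
  · rw [numCont_one_add_two_of_lt hd m h]
    have : 0 ≤ (2 ^ d)⁻¹ * numCont d m 1 := mul_nonneg (by positivity) (numCont_pos _ _).le
    linarith

theorem numCont_add_two_mul_le (hd : 1 ≤ d) (m i : ℕ) :
    numCont d (m + 2 * i) 1 ≤ 2 ^ i * (1 + (2 ^ d)⁻¹) ^ i * numCont d m 1 := by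
  induction i with
  | zero => simp
  | succ i ih =>
    rw [show m + 2 * (i + 1) = m + 2 * i + 2 by ring]
    refine (numCont_add_two_le hd _).trans ((mul_le_mul_of_nonneg_left ih (by positivity)).trans ?_)
    rw [pow_succ, pow_succ]
    exact le_of_eq (by ring)

theorem numCont_add_two_mul_self_le (hd : 1 ≤ d) (m : ℕ) :
    numCont d (m + 2 * d) 1 ≤ 3 * 2 ^ d * numCont d m 1 := by
  refine (numCont_add_two_mul_le hd m d).trans
    (mul_le_mul_of_nonneg_right ?_ (numCont_pos _ _).le)
  have h1 : (1 + ((2 : ℝ) ^ d)⁻¹) ^ d ≤ 3 := by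
    have hle : (d : ℝ) * (2 ^ d)⁻¹ ≤ 1 := by
      rw [← div_eq_mul_inv, div_le_one (by positivity)]
      exact_mod_cast (Nat.lt_two_pow_self (n := d)).le
    calc (1 + ((2 : ℝ) ^ d)⁻¹) ^ d ≤ (Real.exp (2 ^ d)⁻¹) ^ d := by
          gcongr
          rw [add_comm]
          exact Real.add_one_le_exp _
      _ = Real.exp (d * (2 ^ d)⁻¹) := (Real.exp_nat_mul _ _).symm
      _ ≤ Real.exp 1 := Real.exp_le_exp.2 hle
      _ ≤ 3 := Real.exp_one_lt_three.le
  rw [mul_comm (3 : ℝ)]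
  gcongr

/-- The total count is dominated by the homomorphisms whose first run has length one. -/
theorem numCont_long_succ_le (hd : 1 ≤ d) (m : ℕ) :
    numCont d (m + 1) (2 * d + 1) ≤ 4 * numCont d m 1 := by
  have key : ∀ m, numCont d (m + 2) (2 * d + 1) ≤
      2 * numCont d (m + 1) 1 + 2 * numCont d m 1 := by
    intro m
    induction m with
    | zero =>
      rw [numCont_succ_of_long _ _ (by omega), numCont_succ_of_long _ _ (by omega)]
      have h1 := one_le_numCont (d := d) 1 1
      simp only [zero_add]
      rw [numCont, numCont]
      linarith
    | succ m ih =>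
      rw [numCont_succ_of_long _ _ (by omega)]
      have := two_mul_numCont_le hd m
      linarith
  cases m with
  | zero =>
    rw [numCont_succ_of_long _ _ (by omega), numCont, numCont]
    norm_num
  | succ m =>
    have := key m
    have := numCont_le_succ (d := d) m 1
    linarith

/-! ### The first moment -/

variable {r : ℕ}

theorem firstMoment_zero_one : firstMoment d r 0 1 = numCont d r 1 := by
  simp [firstMoment]

theorem firstMoment_one_one (hd : 1 ≤ d) : firstMoment d r 1 1 = 0 := by
  rw [firstMoment, firstMoment, if_pos (by decide), if_neg (by decide), if_neg (by omega), add_zero]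

theorem firstMoment_one_add_two (hd : 1 ≤ d) (m : ℕ) :
    firstMoment d r (m + 2) 1 = firstMoment d r m 3 - firstMoment d r m 1 := by
  rw [firstMoment, firstMoment, if_pos (by decide), if_neg (by decide), if_neg (by omega)]
  ring

theorem secondMoment_zero_one : secondMoment d r 0 1 = numCont d r 1 := by
  simp [secondMoment]

theorem secondMoment_one_one (hd : 1 ≤ d) : secondMoment d r 1 1 = 0 := by
  rw [secondMoment, secondMoment, if_pos (by decide), if_neg (by decide), if_neg (by omega),
    add_zero]

theorem secondMoment_one_add_two (hd : 1 ≤ d) (m : ℕ) :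
    secondMoment d r (m + 2) 1 = secondMoment d r m 3 + secondMoment d r m 1 := by
  rw [secondMoment, secondMoment, if_pos (by decide), if_neg (by decide), if_neg (by omega)]
  ring

theorem initial_add_two_of_long (ℓ : ℕ) (hℓ : 2 * d ≤ ℓ) :
    (if Even (ℓ + 2) then 0 else numCont d r (ℓ + 2)) = if Even ℓ then 0 else numCont d r ℓ := by
  rw [numCont_add_two_of_long r ℓ hℓ]
  by_cases h1 : Even ℓ
  · rw [if_pos h1, if_pos (by grind)]
  · rw [if_neg h1, if_neg (by grind)]

/-- Prolonging a short run by two leaves room for one additional choice at most, namely to end the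
run with length `2 d + 1`. -/
theorem initial_add_two_sub (hd : 1 ≤ d) (ℓ : ℕ) (hℓ1 : 1 ≤ ℓ) (hℓ : ℓ + 1 ≤ 2 * d) :
    0 ≤ (if Even (ℓ + 2) then 0 else numCont d r (ℓ + 2)) - (if Even ℓ then 0 else numCont d r ℓ) ∧
      (if Even (ℓ + 2) then 0 else numCont d r (ℓ + 2)) - (if Even ℓ then 0 else numCont d r ℓ) ≤
        numCont d (r + ℓ + 1) 1 - 2 * numCont d (r + ℓ - 1) 1 := by
  by_cases h1 : Even ℓ
  · rw [if_pos h1, if_pos (by grind), sub_zero]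
    refine ⟨le_rfl, sub_nonneg.2 ?_⟩
    have h2 := two_mul_numCont_le hd (r + ℓ - 1)
    rwa [show r + ℓ - 1 + 2 = r + ℓ + 1 by omega] at h2
  · rw [if_neg h1, if_neg (by grind)]
    rcases Nat.lt_or_ge (r + ℓ) (2 * d) with h | h
    · rw [run_recursion_add_two_of_lt (d := d) numCont_recursion r ℓ (by omega)]
      have h2 := two_mul_numCont_le hd (r + ℓ - 1)
      rw [show r + ℓ - 1 + 2 = r + ℓ + 1 by omega] at h2
      simpa [numCont] using h2
    · obtain ⟨j, hj⟩ : ∃ j, r + ℓ = j + 2 * d := ⟨r + ℓ - 2 * d, by omega⟩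
      obtain ⟨i, hi⟩ : ∃ i, ℓ + i + 1 = 2 * d := ⟨2 * d - ℓ - 1, by omega⟩
      obtain rfl : r = j + i + 1 := by omega
      rw [run_recursion_add_two (d := d) numCont_recursion (fun _ _ => rfl) j i ℓ hi, hj,
        numCont_one_add hd]
      have := numCont_pos (d := d) j 1
      constructor <;> linarith

/-- For a run that has just begun, ending it after two steps nearly cancels against prolonging it by
two steps: what is left comes from runs of length `2 d + 1`. -/
theorem firstMoment_one_add (hd : 1 ≤ d) (j : ℕ) :
    firstMoment d r (j + 2 * d + 1) 1 = numCont d (j + r) 1 + firstMoment d r j 1 := by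
  have h := run_recursion_add_two (d := d) (X := firstMoment d r) (fun _ _ => rfl)
    initial_add_two_of_long j (2 * d - 2) 1 (by omega)
  rw [show j + (2 * d - 2) + 1 = j + 2 * d - 1 by omega] at h
  rw [show j + 2 * d + 1 = j + 2 * d - 1 + 2 by omega, firstMoment_one_add_two hd, h]
  ring

theorem firstMoment_one_add_two_of_lt (hd : 1 ≤ d) (m : ℕ) (hm : m + 2 ≤ 2 * d) :
    0 ≤ firstMoment d r (m + 2) 1 ∧
      firstMoment d r (m + 2) 1 ≤ numCont d (m + 2 + r) 1 := by
  have h := run_recursion_add_two_of_lt (d := d) (X := firstMoment d r) (fun _ _ => rfl) m 1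
    (by omega)
  obtain ⟨h1, h2⟩ := initial_add_two_sub (r := r) hd (1 + m) (by omega) (by omega)
  rw [show r + (1 + m) + 1 = m + 2 + r by omega] at h2
  have := numCont_pos (d := d) (r + (1 + m) - 1) 1
  rw [firstMoment_one_add_two hd, h]
  simp only [firstMoment]
  constructor <;> linarith

theorem firstMoment_bounds (hd : 1 ≤ d) (m : ℕ) :
    0 ≤ firstMoment d r m 1 ∧ firstMoment d r m 1 ≤ numCont d (m + r) 1 := by
  induction m using Nat.strong_induction_on with
  | _ m ih =>
    match m with
    | 0 =>
      rw [firstMoment_zero_one, zero_add]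
      exact ⟨(numCont_pos _ _).le, le_rfl⟩
    | 1 =>
      rw [firstMoment_one_one hd]
      exact ⟨le_rfl, (numCont_pos _ _).le⟩
    | m + 2 =>
      rcases Nat.lt_or_ge (2 * d) (m + 2) with h | h
      · obtain ⟨j, hj⟩ : ∃ j, m + 2 = j + 2 * d + 1 := ⟨m + 1 - 2 * d, by omega⟩
        obtain ⟨h1, h2⟩ := ih j (by omega)
        rw [hj, firstMoment_one_add hd, show j + 2 * d + 1 + r = j + r + 2 * d + 1 by ring,
          numCont_one_add hd]
        have h3 := numCont_pos (d := d) (j + r) 1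
        have h4 : numCont d (j + r) 1 ≤ numCont d (j + r + 2 * d - 1) 1 :=
          numCont_mono 1 (by omega)
        constructor <;> linarith
      · exact firstMoment_one_add_two_of_lt hd m h

/-! ### The second moment -/

/-- The recursion for the second moment is that for the number of continuations, up to a source term
that is present only if a run of odd length has been completed. -/
theorem secondMoment_one_add (hd : 1 ≤ d) (j : ℕ) :
    secondMoment d r (j + 2 * d + 1) 1 = 2 * secondMoment d r (j + 2 * d - 1) 1 +
      (numCont d (j + r) 1 + 2 * firstMoment d r j 1 + secondMoment d r j 1) := by
  have h := run_recursion_add_two (d := d) (X := secondMoment d r) (fun _ _ => rfl)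
    initial_add_two_of_long j (2 * d - 2) 1 (by omega)
  rw [show j + (2 * d - 2) + 1 = j + 2 * d - 1 by omega] at h
  rw [show j + 2 * d + 1 = j + 2 * d - 1 + 2 by omega, secondMoment_one_add_two hd, h]
  ring

theorem secondMoment_one_add_two_of_lt (hd : 1 ≤ d) (m : ℕ) (hm : m + 2 ≤ 2 * d) :
    2 * secondMoment d r m 1 ≤ secondMoment d r (m + 2) 1 ∧
      secondMoment d r (m + 2) 1 ≤ 2 * secondMoment d r m 1 +
        (numCont d (m + 2 + r) 1 - 2 * numCont d (m + r) 1) := by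
  have h := run_recursion_add_two_of_lt (d := d) (X := secondMoment d r) (fun _ _ => rfl) m 1
    (by omega)
  obtain ⟨h1, h2⟩ := initial_add_two_sub (r := r) hd (1 + m) (by omega) (by omega)
  rw [show r + (1 + m) + 1 = m + 2 + r by omega, show r + (1 + m) - 1 = m + r by omega] at h2
  rw [secondMoment_one_add_two hd]
  simp only [secondMoment] at h
  constructor <;> linarith

theorem secondMoment_nonneg (hd : 1 ≤ d) (m ℓ : ℕ) : 0 ≤ secondMoment d r m ℓ := by
  induction m generalizing ℓ with
  | zero =>
    rw [secondMoment]
    split_ifs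
    · exact le_rfl
    · exact (numCont_pos _ _).le
  | succ m ih =>
    have h1 := ih (ℓ + 1)
    have h2 := ih 1
    have h3 := (firstMoment_bounds (r := r) hd m).1
    have h4 := numCont_pos (d := d) (m + r) 1
    rw [secondMoment]
    split_ifs <;> linarith

theorem secondMoment_one_le (hd : 1 ≤ d) (m : ℕ) :
    secondMoment d r m 1 ≤ (2 * (2 ^ d)⁻¹ * m + 1) * numCont d (m + r) 1 := by
  have hp : (0 : ℝ) < 2 ^ d := by positivity
  set θ : ℝ := (2 ^ d)⁻¹ with hθ
  have hθ0 : 0 < θ := inv_pos.2 hp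
  induction m using Nat.strong_induction_on with
  | _ m ih =>
    match m with
    | 0 =>
      rw [secondMoment_zero_one, zero_add]
      simp
    | 1 =>
      rw [secondMoment_one_one hd]
      have := numCont_pos (d := d) (1 + r) 1
      positivity
    | m + 2 =>
      rcases Nat.lt_or_ge (2 * d) (m + 2) with h | h
      · obtain ⟨j, hj⟩ : ∃ j, m = j + 2 * d - 1 := ⟨m + 1 - 2 * d, by omega⟩
        have hjm : m + 2 = j + 2 * d + 1 := by omega
        have hcast : (j : ℝ) ≤ m := by exact_mod_cast (by omega : j ≤ m)
        have h1 := ih j (by omega)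
        have h2 := ih m (by omega)
        have h3 := (firstMoment_bounds (r := r) hd j).2
        have h4 := numCont_pos (d := d) (j + r) 1
        -- The source is at most `3` times `numCont d (j + r) 1`, which is of order `2⁻ᵈ`.
        have h5 : numCont d (j + r) 1 ≤ 2 * θ * numCont d (m + r) 1 := by
          have h6 := two_pow_mul_numCont_le hd (j + r) (d - 1)
          have h7 : numCont d (j + r + 2 * (d - 1)) 1 ≤ numCont d (m + r) 1 :=
            numCont_mono 1 (by omega)
          have h8 : (2 : ℝ) ^ d = 2 * 2 ^ (d - 1) := by rw [← pow_succ']; congr 1; omega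
          rw [hθ, mul_assoc, mul_left_comm, le_inv_mul_iff₀ hp, h8]
          linarith
        rw [hjm, secondMoment_one_add hd, ← hj,
          show j + 2 * d + 1 + r = j + r + 2 * d + 1 by ring, numCont_one_add hd,
          show j + r + 2 * d - 1 = m + r by omega, ← hjm]
        push_cast
        have h9 : 2 * θ * j * numCont d (j + r) 1 ≤ 2 * θ * m * numCont d (j + r) 1 := by gcongr
        have h10 : 0 ≤ θ * numCont d (m + r) 1 := mul_nonneg hθ0.le (numCont_pos _ _).le
        have h11 : 0 ≤ θ * numCont d (j + r) 1 := mul_nonneg hθ0.le h4.le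
        nlinarith
      · have h1 := (secondMoment_one_add_two_of_lt (r := r) hd m h).2
        have h2 := ih m (by omega)
        have h3 := two_mul_numCont_le hd (m + r)
        rw [show m + r + 2 = m + 2 + r by ring] at h3
        push_cast
        have h4 : 2 * θ * m * (2 * numCont d (m + r) 1) ≤ 2 * θ * m * numCont d (m + 2 + r) 1 := by
          gcongr
        have h5 : 0 ≤ θ * numCont d (m + 2 + r) 1 := mul_nonneg hθ0.le (numCont_pos _ _).le
        linarith

/-- The second moment grows linearly, at a rate of order `2⁻ᵈ`, after an initial stretch of length
`2 d + 1`. -/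
theorem le_secondMoment_one (hd : 1 ≤ d) (m : ℕ) :
    (2 ^ d)⁻¹ / 16 * ((m : ℝ) - (2 * d + 1)) * numCont d (m + r) 1 ≤ secondMoment d r m 1 := by
  have hp : (0 : ℝ) < 2 ^ d := by positivity
  set α : ℝ := (2 ^ d)⁻¹ / 16 with hα
  have hα0 : 0 < α := by positivity
  induction m using Nat.strong_induction_on with
  | _ m ih =>
    rcases Nat.lt_or_ge (2 * d) m with h | h
    · obtain ⟨j, hj⟩ : ∃ j, m = j + 2 * d + 1 := ⟨m - (2 * d + 1), by omega⟩
      obtain ⟨i, hi⟩ : ∃ i, i = j + 2 * d - 1 := ⟨_, rfl⟩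
      have h1 := ih j (by omega)
      have h2 := ih i (by omega)
      have h3 := (firstMoment_bounds (r := r) hd j).1
      have h4 := numCont_pos (d := d) (j + r) 1
      have hi' : (i : ℝ) = j + 2 * d - 1 := by
        rw [eq_sub_iff_add_eq]
        exact_mod_cast (by omega : i + 1 = j + 2 * d)
      have h5 : numCont d (i + r) 1 ≤ 3 * 2 ^ d * numCont d (j + r) 1 :=
        (numCont_mono 1 (by omega : i + r ≤ j + r + 2 * d)).trans
          (numCont_add_two_mul_self_le hd (j + r))
      have h6 : α * numCont d (i + r) 1 ≤ 3 / 16 * numCont d (j + r) 1 := by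
        calc α * numCont d (i + r) 1 ≤ α * (3 * 2 ^ d * numCont d (j + r) 1) := by gcongr
          _ = 3 / 16 * numCont d (j + r) 1 := by rw [hα]; field_simp
      have h7 : α * (2 * d + 1) ≤ 1 / 4 := by
        have h8 : ((d : ℝ) + 1) ≤ 2 ^ d := by exact_mod_cast Nat.lt_two_pow_self (n := d)
        calc α * (2 * d + 1) ≤ α * (2 * 2 ^ d) := by gcongr; linarith
          _ ≤ 1 / 4 := by
            have : α * 2 ^ d = 1 / 16 := by rw [hα]; field_simp
            linarith
      rw [hj, secondMoment_one_add hd, ← hi,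
        show j + 2 * d + 1 + r = j + r + 2 * d + 1 by ring, numCont_one_add hd,
        show j + r + 2 * d - 1 = i + r by omega]
      rw [hi'] at h2
      push_cast
      have h8 : α * (2 * d + 1) * numCont d (j + r) 1 ≤ 1 / 4 * numCont d (j + r) 1 := by gcongr
      nlinarith
    · refine le_trans ?_ (secondMoment_nonneg hd m 1)
      have h1 : (m : ℝ) ≤ 2 * d := by exact_mod_cast h
      exact mul_nonpos_of_nonpos_of_nonneg
        (mul_nonpos_of_nonneg_of_nonpos hα0.le (by linarith)) (numCont_pos _ _).le

theorem secondMoment_le_of_long (hd : 1 ≤ d) (m ℓ : ℕ) (hℓ : 2 * d < ℓ) :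
    secondMoment d r m ℓ ≤ (2 * (2 ^ d)⁻¹ * m + 4) * numCont d (m + r) ℓ := by
  have hθ0 : (0 : ℝ) < (2 ^ d)⁻¹ := by positivity
  induction m generalizing ℓ with
  | zero =>
    have h1 := numCont_pos (d := d) r ℓ
    rw [secondMoment, zero_add]
    push_cast
    split_ifs <;> linarith
  | succ m ih =>
    have h1 := ih (ℓ + 1) (by omega)
    have h2 := secondMoment_one_le (r := r) hd m
    have h3 := (firstMoment_bounds (r := r) hd m).2
    have h4 := numCont_pos (d := d) (m + r) 1
    have h5 : 0 ≤ (2 ^ d)⁻¹ * numCont d (m + 1 + r) ℓ := mul_nonneg hθ0.le (numCont_pos _ _).le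
    have h6 : numCont d (m + 1 + r) ℓ = numCont d (m + r) (ℓ + 1) + numCont d (m + r) 1 := by
      rw [show m + 1 + r = m + r + 1 by ring, numCont, if_pos (Or.inr hℓ)]
    rw [secondMoment, if_pos hℓ]
    push_cast
    rw [h6] at h5 ⊢
    split_ifs <;> nlinarith

/-- A continuation that ends at odd distance from its centre has displacement at least one. -/
theorem numCont_le_secondMoment_of_odd (hd : 1 ≤ d) (m ℓ : ℕ) (h : Odd (m + ℓ)) :
    numCont d (m + r) ℓ ≤ secondMoment d r m ℓ := by
  induction m generalizing ℓ with
  | zero => rw [secondMoment, if_neg (by grind), zero_add]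
  | succ m ih =>
    have h1 := ih (ℓ + 1) (by grind)
    rw [show m + 1 + r = m + r + 1 by ring, numCont_recursion, secondMoment]
    refine add_le_add h1 ?_
    split_ifs with h2 h3
    · exact ih 1 (by grind)
    · have h4 := (firstMoment_bounds (r := r) hd m).1
      have h5 := secondMoment_nonneg (r := r) hd m 1
      linarith
    · exact le_rfl

/-- At even distance the displacement may vanish. Induct by two steps of the run, in the course of
which there is one chance to end it with even length and one with odd length; the odd one alone has
squared displacements, at distance of odd parity from the new centre, that make up for both. -/
theorem numCont_le_secondMoment_of_even (hd : 1 ≤ d) (i ℓ : ℕ) (hℓ : 2 * d < ℓ) (hodd : ¬ Even ℓ) :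
    numCont d (2 * i + 1 + r) ℓ ≤ secondMoment d r (2 * i + 1) ℓ := by
  induction i generalizing ℓ with
  | zero =>
    rw [mul_zero, zero_add, secondMoment, secondMoment, if_pos (by grind), if_neg hodd, if_pos hℓ,
      firstMoment_zero_one, secondMoment_zero_one, zero_add, zero_add,
      numCont_eq_of_long _ ℓ (2 * d + 1) hℓ (by omega), add_comm 1 r]
    linarith [numCont_long_succ_le hd r]
  | succ i ih =>
    have h1 := ih (ℓ + 2) (by omega) (by grind)
    have h2 := numCont_le_secondMoment_of_odd (r := r) hd (2 * i + 2) 1 ⟨i + 1, by ring⟩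
    have h3 := (firstMoment_bounds (r := r) hd (2 * i + 2)).1
    have h4 := secondMoment_nonneg (r := r) hd (2 * i + 1) 1
    have h5 := numCont_le_succ (d := d) (2 * i + 1 + r) 1
    have h6 : secondMoment d r (2 * i + 2) (ℓ + 1) =
        secondMoment d r (2 * i + 1) (ℓ + 2) + secondMoment d r (2 * i + 1) 1 := by
      rw [secondMoment, if_pos (by grind)]
    rw [show 2 * (i + 1) + 1 + r = 2 * i + 1 + r + 1 + 1 by ring, numCont_succ_of_long _ _ hℓ,
      numCont_succ_of_long _ _ hℓ, show 2 * (i + 1) + 1 = 2 * i + 2 + 1 by ring, secondMoment,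
      if_neg hodd, if_pos hℓ, h6]
    rw [numCont_add_two_of_long _ _ (by omega)] at h1
    rw [show 2 * i + 2 + r = 2 * i + 1 + r + 1 by ring] at h2 ⊢
    linarith

theorem numCont_le_secondMoment_of_long (hd : 1 ≤ d) (m : ℕ) :
    numCont d (m + r) (2 * d + 1) ≤ secondMoment d r m (2 * d + 1) := by
  rcases Nat.even_or_odd' m with ⟨i, rfl | rfl⟩
  · exact numCont_le_secondMoment_of_odd hd _ _ ⟨i + d, by ring⟩
  · exact numCont_le_secondMoment_of_even hd i _ (by omega) (by simp)

/-- For displacements of order one the bound follows from the trivial lower bound, otherwise from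
the linear growth after an initial run of length one. -/
theorem linear_le_secondMoment_of_long (hd : 1 ≤ d) (m : ℕ) :
    1 / 128 * ((m : ℝ) + 1) * (2 ^ d)⁻¹ * numCont d (m + r) (2 * d + 1) ≤
      secondMoment d r m (2 * d + 1) := by
  have hp : (0 : ℝ) < 2 ^ d := by positivity
  have hθ0 : (0 : ℝ) < (2 ^ d)⁻¹ := by positivity
  set θ : ℝ := (2 ^ d)⁻¹ with hθ
  have hB := numCont_pos (d := d) (m + r) (2 * d + 1)
  rcases le_or_gt (((m : ℝ) + 1) * θ) 128 with h | h
  · refine le_trans ?_ (numCont_le_secondMoment_of_long hd m)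
    have : 1 / 128 * ((m : ℝ) + 1) * θ ≤ 1 := by linarith
    nlinarith
  · have hd2 : (d : ℝ) * θ ≤ 1 := by
      rw [hθ, ← div_eq_mul_inv, div_le_one hp]
      exact_mod_cast (Nat.lt_two_pow_self (n := d)).le
    have hθ1 : θ ≤ 1 := inv_le_one_of_one_le₀ (one_le_pow₀ one_le_two)
    cases m with
    | zero => norm_num at h; linarith
    | succ m =>
      have h1 := le_secondMoment_one (r := r) hd m
      have h2 := (firstMoment_bounds (r := r) hd m).1
      have h3 := secondMoment_nonneg (r := r) hd m (2 * d + 2)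
      have h4 := numCont_pos (d := d) (m + r) 1
      have h5 := numCont_long_succ_le hd (m + r)
      rw [secondMoment, if_neg (by simp), if_pos (by omega),
        show m + 1 + r = m + r + 1 by ring]
      push_cast at h ⊢
      have h6 : 1 / 128 * ((m : ℝ) + 1 + 1) * θ * numCont d (m + r + 1) (2 * d + 1) ≤
          1 / 128 * ((m : ℝ) + 1 + 1) * θ * (4 * numCont d (m + r) 1) := by
        gcongr
      have h7 : 1 / 32 * ((m : ℝ) + 1 + 1) * θ ≤ θ / 16 * ((m : ℝ) - (2 * d + 1)) := by
        linarith
      have h8 := mul_le_mul_of_nonneg_right h7 h4.le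
      linarith

end Analysis

/-! ### From sums to the variance -/

open MeasureTheory ProbabilityTheory in
theorem integral_lineHomLaw (n d : ℕ) (φ : (Fin (n + 1) → ℤ) → ℝ) :
    ∫ g, φ g ∂lineHomLaw n d = (∑ g ∈ homFinset n d, φ g) / (homFinset n d).card := by
  have hcoe : homZ (lineGraph n d) 0 = homFinset n d := by simp [homFinset]
  rw [lineHomLaw, uniformOn, ProbabilityTheory.cond, hcoe, integral_smul_measure,
    Measure.count_apply_finset, setIntegral_finset]
  · simp [Measure.real, div_eq_inv_mul]
  · rw [← (homFinset n d : Set (Fin (n + 1) → ℤ)).biUnion_of_singleton]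
    simp [integrableOn_finset_iUnion]

/-- The reflection `f ↦ -f` preserves the homomorphisms, so the mean vanishes. -/
theorem sum_homFinset_apply (n d : ℕ) (k : Fin (n + 1)) :
    ∑ g ∈ homFinset n d, (g k : ℝ) = 0 := by
  have hneg : ∀ g ∈ homFinset n d, -g ∈ homFinset n d := by
    intro g hg
    rw [mem_homFinset] at hg ⊢
    refine ⟨by simp [hg.1], fun i j hij hd ho => ?_⟩
    rw [← hg.2 i j hij hd ho, ← abs_neg]
    congr 1
    simp only [Pi.neg_apply]
    ring
  have h : ∑ g ∈ homFinset n d, (g k : ℝ) = ∑ g ∈ homFinset n d, -(g k : ℝ) :=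
    Finset.sum_nbij' (fun g => -g) (fun g => -g) hneg hneg (by simp) (by simp) (by simp)
  rw [Finset.sum_neg_distrib] at h
  linarith

theorem variance_lineHomLaw (n d : ℕ) (k : Fin (n + 1)) :
    ProbabilityTheory.variance (fun f : Fin (n + 1) → ℤ => (f k : ℝ)) (lineHomLaw n d) =
      (∑ g ∈ homFinset n d, (g k : ℝ) ^ 2) / (homFinset n d).card := by
  have hmeas : Measurable fun f : Fin (n + 1) → ℤ => (f k : ℝ) :=
    measurable_from_top.comp (measurable_pi_apply k)
  rw [ProbabilityTheory.variance_of_integral_eq_zero hmeas.aemeasurable]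
  · exact integral_lineHomLaw n d fun f => (f k : ℝ) ^ 2
  · rw [integral_lineHomLaw, sum_homFinset_apply, zero_div]

theorem theorem2p4 :
    ∃ c C : ℝ, 0 < c ∧ 0 < C ∧
      ∀ n d : ℕ, 1 ≤ n → 1 ≤ d → ∀ k : Fin (n + 1), 1 ≤ (k : ℕ) →
        max (c * (k : ℕ) * (2 : ℝ) ^ (-(d : ℤ))) 1 ≤
            ProbabilityTheory.variance (fun f : Fin (n + 1) → ℤ => (f k : ℝ)) (lineHomLaw n d) ∧
          ProbabilityTheory.variance (fun f : Fin (n + 1) → ℤ => (f k : ℝ)) (lineHomLaw n d) ≤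
            C * (k : ℕ) * (2 : ℝ) ^ (-(d : ℤ)) + 4 := by
  refine ⟨1 / 128, 2, by norm_num, by norm_num, fun n d _ hd k hk => ?_⟩
  obtain ⟨m, hm⟩ : ∃ m, m + 1 = (k : ℕ) := ⟨k - 1, by omega⟩
  obtain ⟨r, hr⟩ : ∃ r, (k : ℕ) + r = n := ⟨n - k, by omega⟩
  have hB := numCont_pos (d := d) (m + r) (2 * d + 1)
  have hk' : ((k : ℕ) : ℝ) = m + 1 := by rw [← hm]; push_cast; ring
  rw [variance_lineHomLaw, sum_sq_homFinset hd k hm hr,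
    card_homFinset hd (by omega : m + r + 1 = n), mul_div_mul_left _ _ two_ne_zero, zpow_neg,
    zpow_natCast, hk', le_div_iff₀ hB, div_le_iff₀ hB, max_mul_of_nonneg _ _ hB.le, one_mul]
  refine ⟨max_le (linear_le_secondMoment_of_long hd m) (numCont_le_secondMoment_of_long hd m),
    (secondMoment_le_of_long hd m _ (by omega)).trans ?_⟩
  have : (0 : ℝ) < (2 ^ d)⁻¹ := by positivity
  refine mul_le_mul_of_nonneg_right ?_ hB.le
  linarith
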